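/- Let $\mathbb K\in\{\mathbb R,\mathbb C\}$ and let $A:\mathbb K\to\mathbb C^{m\times m}$ be continuous with a full asymptotic expansion $A(\rho)\sim A_0+\rho A_1+\rho^2A_2+\cdots$ as $\rho\to0$, i.e. $A(\rho)=\sum_{j=0}^N\rho^jA_j+\mathcal O(\rho^{N+1})$ for every $N$. The multi-step scheme is the following recursion. Put $\tilde\Lambda_0=A_0$. Whenever $\tilde\Lambda_0$ is diagonable (similar to a diagonal matrix), choose an invertible $\tilde M_0=M_0$ with $M_0^{-1}A_0M_0=\Lambda_0$ diagonal and put $\tilde A^{[0]}(\rho)=M_0^{-1}A(\rho)M_0$. Suppose that for some $k\ge0$ we have $\tilde A^{[k]}(\rho)\sim\Lambda_0+\rho\Lambda_1+\cdots+\rho^k\Lambda_k+\rho^{k+1}\tilde A^{[k]}_{k+1}+\cdots$ with diagonal matrices $\Lambda_j=\operatorname{diag}(\lambda^{[j]}_1,\dots,\lambda^{[j]}_m)$. For $\ell\le k$ let $\Pi_\ell$ be the partition of $\{1,\dots,m\}$ in which $i,j$ are equivalent iff $\lambda_i^{[\ell']}=\lambda_j^{[\ell']}$ for all $\ell'\le\ell$,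 let $\Pi_{-1}$ be the partition with one block, and let $\operatorname{bdiag}_{\Pi}$ keep the entries of a matrix inside the blocks of $\Pi$ and replace all other entries by $0$. Put $A^{[k,-1]}_{k+1}=\tilde A^{[k]}_{k+1}$, $A^{[k,\ell]}_{k+1}=\operatorname{bdiag}_{\Pi_\ell}A^{[k,\ell-1]}_{k+1}$ for $\ell=0,\dots,k$, and $\tilde\Lambda_{k+1}=A^{[k,k]}_{k+1}$. If $\tilde\Lambda_{k+1}$ is diagonable, choose a $\Pi_k$-block-diagonal invertible $\tilde M_{k+1}$ such that $\Lambda_{k+1}=\tilde M_{k+1}^{-1}\tilde\Lambda_{k+1}\tilde M_{k+1}$ is diagonal, and for $\ell=0,\dots,k$ a $\Pi_{\ell-1}$-block-diagonal solution $K^{[k]}_\ell$ of $[\Lambda_\ell,K^{[k]}_\ell]+A^{[k,\ell-1]}_{k+1}-A^{[k,\ell]}_{k+1}=0$, and continue with $$\tilde A^{[k+1]}(\rho)=T_k(\rho)^{-1}\tilde A^{[k]}(\rho)T_k(\rho),\qquad T_k(\rho)=(I+\rho^{k+1}K^{[k]}_0)(I+\rho^{k}K^{[k]}_1)\cdots(I+\rho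 K^{[k]}_k)\,\tilde M_{k+1}.$$ Let $n\ge0$ and suppose that $A(\rho)$ satisfies Assumption $(\mathbf A_n)$: the scheme can be carried out so that the matrices $\tilde\Lambda_0,\dots,\tilde\Lambda_n$ are all diagonable. Then there exist $\epsilon>0$, matrices $M_n(\rho)\in\mathbb C^{m\times m}$, diagonal matrices $D_n(\rho)$, and a constant $C$ such that for all $\rho\in I_n=\{\rho\in\mathbb K:|\rho|<\epsilon\}$ the matrix $M_n(\rho)$ is invertible, $\|M_n(\rho)\|\le C$, $\|M_n(\rho)^{-1}\|\le C$, and $$\bigl\|M_n^{-1}(\rho)A(\rho)M_n(\rho)-D_n(\rho)\bigr\|\le C|\rho|^{n+1},$$ i.e. $M_n^{-1}(\rho)A(\rho)M_n(\rho)$ is diagonal modulo $\mathcal O(\rho^{n+1})$ on $I_n$. -/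

import Mathlib

open Filter Topology Asymptotics

-- The matrix norm used throughout is the operator norm for the sup norm on `ℂ^m`
-- (all norms on `ℂ^{m × m}` are equivalent).
attribute [local instance] Matrix.linftyOpNormedRing

/-- Complex `m × m` matrices. -/
abbrev Mat (m : ℕ) : Type := Matrix (Fin m) (Fin m) ℂ

/-- `A(ρ) = A₀ + ρ A₁ + ⋯ + ρ^N A_N + O(ρ^{N+1})` as `ρ → 0`, for every `N`. -/
def HasAsymptoticExpansion {𝕜 : Type*} [RCLike 𝕜] [NormedAlgebra 𝕜 ℂ] {m : ℕ}
    (A : 𝕜 → Mat m) (a : ℕ → Mat m) : Prop :=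
  ∀ N : ℕ, (fun ρ : 𝕜 => A ρ - ∑ j ∈ Finset.range (N + 1), ρ ^ j • a j)
    =O[𝓝[≠] (0 : 𝕜)] fun ρ : 𝕜 => ρ ^ (N + 1)

/-- A matrix is diagonable if it is similar to a diagonal matrix. -/
def Diagonable {m : ℕ} (B : Mat m) : Prop :=
  ∃ P : (Mat m)ˣ, ((↑P⁻¹ : Mat m) * B * (P : Mat m)).IsDiag

/-- `B` is block-diagonal with respect to the partition given by the relation `r`. -/
def IsBlockDiag {m : ℕ} (r : Fin m → Fin m → Prop) (B : Mat m) : Prop :=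
  ∀ i j, ¬ r i j → B i j = 0

open Classical in
/-- The operator `bdiag`: keep the entries inside the blocks of `r`, delete all the others. -/
noncomputable def bdiag {m : ℕ} (r : Fin m → Fin m → Prop) (B : Mat m) : Mat m :=
  Matrix.of fun i j => if r i j then B i j else 0

/-- The matrices chosen while the multi-step scheme is carried out. -/
structure SchemeChoices (m : ℕ) where
  /-- `M 0` is the diagonaliser of `A₀`, and `M (k + 1)` the one of `Λ̃_{k+1}`. -/
  M : ℕ → (Mat m)ˣ
  /-- `K k l` is the matrix `K^{[k]}_l` of the `l`-th sub-step (`0 ≤ l ≤ k`) of step `k`. -/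
  K : ℕ → ℕ → Mat m

namespace SchemeChoices

variable {m : ℕ}

/-- The transformation of step `k`, as a polynomial in `ρ`:
`(I + ρ^{k+1} K^{[k]}_0) (I + ρ^k K^{[k]}_1) ⋯ (I + ρ K^{[k]}_k) M_{k+1}`. -/
noncomputable def stepTransform (S : SchemeChoices m) (k : ℕ) : PowerSeries (Mat m) :=
  ((List.range (k + 1)).map fun l =>
      (1 + PowerSeries.monomial (k + 1 - l) (S.K k l) : PowerSeries (Mat m))).prod
    * PowerSeries.C (S.M (k + 1) : Mat m)

/-- The inverse of `stepTransform`, as a power series in `ρ`. -/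
noncomputable def stepTransformInv (S : SchemeChoices m) (k : ℕ) : PowerSeries (Mat m) :=
  PowerSeries.invOfUnit (S.stepTransform k) (S.M (k + 1))

theorem constantCoeff_stepTransform (S : SchemeChoices m) (k : ℕ) :
    PowerSeries.constantCoeff (S.stepTransform k) = (S.M (k + 1) : Mat m) := by
  have h : ∀ L : List ℕ, (∀ l ∈ L, l < k + 1) →
      PowerSeries.constantCoeff ((L.map fun l =>
        (1 + PowerSeries.monomial (k + 1 - l) (S.K k l) : PowerSeries (Mat m))).prod) = 1 := by
    intro L
    induction L with
    | nil => intro _; simp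
    | cons l L ih =>
      intro hL
      have hl : l < k + 1 := hL l (by simp)
      have h0 : PowerSeries.constantCoeff
          (PowerSeries.monomial (k + 1 - l) (S.K k l) : PowerSeries (Mat m)) = 0 := by
        rw [← PowerSeries.coeff_zero_eq_constantCoeff_apply, PowerSeries.coeff_monomial,
          if_neg (by omega)]
      rw [List.map_cons, List.prod_cons, map_mul, map_add, map_one, h0,
        ih (fun x hx => hL x (by simp [hx]))]
      simp
  rw [stepTransform, map_mul, h _ (fun l hl => List.mem_range.1 hl)]
  simp

theorem stepTransform_mul_inv (S : SchemeChoices m) (k : ℕ) :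
    S.stepTransform k * S.stepTransformInv k = 1 :=
  PowerSeries.mul_invOfUnit _ _ (S.constantCoeff_stepTransform k)

theorem inv_mul_stepTransform (S : SchemeChoices m) (k : ℕ) :
    S.stepTransformInv k * S.stepTransform k = 1 :=
  PowerSeries.invOfUnit_mul _ _ (S.constantCoeff_stepTransform k)

/-- The asymptotic expansion of the transformed family `Ã^{[k]}(ρ)`, for a family `A(ρ)` with
asymptotic expansion `∑ ρ^j a_j`: `Ã^{[0]} = M₀⁻¹ A M₀`, and `Ã^{[k+1]}` is the conjugate of
`Ã^{[k]}` by the transformation of step `k`. Expansions multiply as formal power series. -/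
noncomputable def expansion (a : ℕ → Mat m) (S : SchemeChoices m) : ℕ → PowerSeries (Mat m)
  | 0 => PowerSeries.C (↑(S.M 0)⁻¹ : Mat m) * PowerSeries.mk a * PowerSeries.C (S.M 0 : Mat m)
  | k + 1 => S.stepTransformInv k * expansion a S k * S.stepTransform k

/-- The matrix `Λ_k`, the coefficient of `ρ^k` in `Ã^{[k]}(ρ)`. -/
noncomputable def Lam (a : ℕ → Mat m) (S : SchemeChoices m) (k : ℕ) : Mat m :=
  PowerSeries.coeff k (expansion a S k)

/-- The equivalence relation of the partition generated by `Λ_0, …, Λ_{p-1}`. Thus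
`SameGroup a S 0` is the trivial partition with one block, and `SameGroup a S (k + 1)` is
`∼_{Π_k}`. -/
def SameGroup (a : ℕ → Mat m) (S : SchemeChoices m) (p : ℕ) (i j : Fin m) : Prop :=
  ∀ q < p, Lam a S q i i = Lam a S q j j

/-- The matrices of the sub-steps of step `k`: `subStep a S k 0` is `Ã^{[k]}_{k+1}`, and
`subStep a S k (l + 1)` is `A^{[k,l]}_{k+1}`, obtained by `bdiag` with respect to `Π_l`. -/
noncomputable def subStep (a : ℕ → Mat m) (S : SchemeChoices m) (k : ℕ) : ℕ → Mat m
  | 0 => PowerSeries.coeff (k + 1) (expansion a S k)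
  | l + 1 => bdiag (SameGroup a S (l + 1)) (subStep a S k l)

/-- The matrices `Λ̃_k` produced by the scheme: `Λ̃_0 = A₀` and `Λ̃_{k+1} = A^{[k,k]}_{k+1}`. -/
noncomputable def LamTilde (a : ℕ → Mat m) (S : SchemeChoices m) : ℕ → Mat m
  | 0 => a 0
  | k + 1 => subStep a S k (k + 1)

/-- The choices `S` are those of the scheme, as far as `Λ̃_0, …, Λ̃_n` depend on them.
The diagonaliser of `Λ̃_k` lives in the blocks of the partition `Π_{k-1}`, and `K^{[k]}_l` is a
`Π_{l-1}`-block-diagonal solution of `[Λ_l, K] + A^{[k,l-1]}_{k+1} - A^{[k,l]}_{k+1} = 0`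
(with `A^{[k,-1]}_{k+1} = Ã^{[k]}_{k+1}`, and `Π_{-1}` the trivial partition). -/
structure IsAdmissible (a : ℕ → Mat m) (S : SchemeChoices m) (n : ℕ) : Prop where
  diagonalises : ∀ k < n,
    ((↑(S.M k)⁻¹ : Mat m) * LamTilde a S k * (S.M k : Mat m)).IsDiag
  blockDiag_M : ∀ k < n, IsBlockDiag (SameGroup a S k) (S.M k : Mat m)
  sylvester : ∀ k, k + 1 < n → ∀ l ≤ k,
    (Lam a S l * S.K k l - S.K k l * Lam a S l) + subStep a S k l - subStep a S k (l + 1) = 0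
  blockDiag_K : ∀ k, k + 1 < n → ∀ l ≤ k, IsBlockDiag (SameGroup a S l) (S.K k l)

end SchemeChoices

/-- Assumption (A_n) on a family with asymptotic expansion `∑ ρ^j a_j`: the scheme can be carried
out so that `Λ̃_0, …, Λ̃_n` are all diagonable. -/
def AssumptionA {m : ℕ} (a : ℕ → Mat m) (n : ℕ) : Prop :=
  ∃ S : SchemeChoices m, SchemeChoices.IsAdmissible a S n ∧
    ∀ k ≤ n, Diagonable (SchemeChoices.LamTilde a S k)

/-!
The scheme is a sequence of conjugations of the formal power series `∑ a_j X ^ j`, and the theorem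
follows from a formal statement (`AssumptionA.exists_formal_diagonalisation`): there are series
`T`, `E` over the matrices with `(∑ a_j X ^ j) T = T E`, where `T` has invertible constant
coefficient and the coefficients of `E` in degrees `0, …, n` are diagonal.

The formal statement rests on one computation (`PowerSeries.exists_conj_one_add_monomial`):
if `K` commutes with the coefficients of `B` in degrees below `l`, then conjugating `B` by
`1 + K X ^ p` leaves the degrees below `p + l` unchanged and adds `[B_l, K]` in degree `p + l`.
With `p + l = k + 1` and the Sylvester equations, the sub-steps of step `k` thus preserve
`Λ_0, …, Λ_k` and turn the coefficient of degree `k + 1` into `Λ̃_{k+1}`; a diagonaliser respecting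
the blocks of `Π_k` then commutes with `Λ_0, …, Λ_k` and makes this coefficient diagonal. The
hypothesis gives such a diagonaliser for `Λ̃_0, …, Λ̃_{n-1}`, but only the diagonability of `Λ̃_n`.
For the last step the Sylvester equations are solved by hand, and the projections of the
eigenvectors of `Λ̃_n` to the blocks of `Π_{n-1}` provide a basis of common eigenvectors of `Λ̃_n`
and `Λ_0, …, Λ_{n-1}` (`Diagonable.exists_simultaneous`).

For the analytic part let `M(ρ)` and `D(ρ)` be the values of the truncations of `T` and `E` after
degree `n`. As truncated evaluation is multiplicative up to `O(ρ ^ (n + 1))`, the formal identity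
gives `A(ρ) M(ρ) - M(ρ) D(ρ) = O(ρ ^ (n + 1))`. Since `M` is continuous with invertible value at
`0`, both `M(ρ)` and its inverse are bounded near `0`, and multiplication by `M(ρ)⁻¹` concludes.
-/

/-! ### Conjugation of formal power series over a noncommutative ring -/

section PowerSeriesRing

variable {R : Type*} [Ring R]

theorem PowerSeries.isUnit_of_constantCoeff {f : PowerSeries R}
    (h : IsUnit (PowerSeries.constantCoeff f)) : IsUnit f := by
  obtain ⟨u, hu⟩ := h
  exact ⟨⟨f, PowerSeries.invOfUnit f u, PowerSeries.mul_invOfUnit _ _ hu.symm,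
    PowerSeries.invOfUnit_mul _ _ hu.symm⟩, rfl⟩

theorem PowerSeries.exists_mul_eq_mul_of_isUnit {f : PowerSeries R} (hf : IsUnit f)
    (g : PowerSeries R) : ∃ g', g * f = f * g' := by
  obtain ⟨u, rfl⟩ := hf
  exact ⟨↑u⁻¹ * (g * u), by simp⟩

theorem PowerSeries.coeff_monomial_mul_ite (p j : ℕ) (K : R) (f : PowerSeries R) :
    PowerSeries.coeff j (PowerSeries.monomial p K * f)
      = if p ≤ j then K * PowerSeries.coeff (j - p) f else 0 := by
  have : PowerSeries.monomial p K = PowerSeries.X ^ p * PowerSeries.C K := by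
    rw [PowerSeries.X_pow_eq, ← PowerSeries.monomial_zero_eq_C_apply,
      PowerSeries.monomial_mul_monomial]
    simp
  rw [this, mul_assoc, PowerSeries.coeff_X_pow_mul', PowerSeries.coeff_C_mul]

theorem PowerSeries.coeff_mul_monomial_ite (p j : ℕ) (K : R) (f : PowerSeries R) :
    PowerSeries.coeff j (f * PowerSeries.monomial p K)
      = if p ≤ j then PowerSeries.coeff (j - p) f * K else 0 := by
  have : PowerSeries.monomial p K = PowerSeries.C K * PowerSeries.X ^ p := by
    rw [PowerSeries.X_pow_eq, ← PowerSeries.monomial_zero_eq_C_apply,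
      PowerSeries.monomial_mul_monomial]
    simp
  rw [this, ← mul_assoc, PowerSeries.coeff_mul_X_pow', PowerSeries.coeff_mul_C]

/-- If `K` commutes with the coefficients of `B` below degree `l`, conjugation of `B` by
`1 + K X ^ p` first shows in degree `p + l`, where it adds the commutator with the `l`-th
coefficient. -/
theorem PowerSeries.exists_conj_one_add_monomial (B : PowerSeries R) (K : R) {p l : ℕ}
    (hp : 0 < p) (hK : ∀ j < l, Commute (PowerSeries.coeff j B) K) :
    ∃ B' : PowerSeries R,
      B * (1 + PowerSeries.monomial p K) = (1 + PowerSeries.monomial p K) * B' ∧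
      (∀ j < p + l, PowerSeries.coeff j B' = PowerSeries.coeff j B) ∧
      PowerSeries.coeff (p + l) B' = PowerSeries.coeff (p + l) B
        + (PowerSeries.coeff l B * K - K * PowerSeries.coeff l B) := by
  have hu : IsUnit (1 + PowerSeries.monomial p K : PowerSeries R) := by
    apply PowerSeries.isUnit_of_constantCoeff
    have : PowerSeries.constantCoeff (PowerSeries.monomial p K : PowerSeries R) = 0 := by
      rw [← PowerSeries.coeff_zero_eq_constantCoeff_apply, PowerSeries.coeff_monomial,
        if_neg hp.ne]
    rw [map_add, map_one, this, add_zero]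
    exact isUnit_one
  obtain ⟨B', hB'⟩ := PowerSeries.exists_mul_eq_mul_of_isUnit hu B
  have hc : ∀ j, PowerSeries.coeff j B' + (if p ≤ j then K * PowerSeries.coeff (j - p) B' else 0)
      = PowerSeries.coeff j B + (if p ≤ j then PowerSeries.coeff (j - p) B * K else 0) := by
    intro j
    have := congrArg (PowerSeries.coeff j) hB'
    rw [mul_add, add_mul, map_add, map_add, PowerSeries.coeff_monomial_mul_ite,
      PowerSeries.coeff_mul_monomial_ite, mul_one, one_mul] at this
    exact this.symm
  have hlow : ∀ j < p + l, PowerSeries.coeff j B' = PowerSeries.coeff j B := by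
    intro j
    induction j using Nat.strong_induction_on with
    | _ j ih =>
      intro hj
      have h := hc j
      split_ifs at h with hpj
      · rw [ih (j - p) (by omega) (by omega), (hK (j - p) (by omega)).eq] at h
        exact add_right_cancel h
      · simpa using h
  refine ⟨B', hB', hlow, ?_⟩
  have h := hc (p + l)
  rw [if_pos (Nat.le_add_right p l), if_pos (Nat.le_add_right p l), Nat.add_sub_cancel_left,
    hlow l (by omega)] at h
  rw [eq_sub_of_add_eq h, add_sub_assoc]

end PowerSeriesRing

/-! ### Diagonal and block-diagonal matrices -/

theorem commute_of_isDiag_of_isBlockDiag {m : ℕ} {r : Fin m → Fin m → Prop} {D B : Mat m}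
    (hD : D.IsDiag) (hr : ∀ i j, r i j → D i i = D j j) (hB : IsBlockDiag r B) :
    Commute D B := by
  have hd : D = Matrix.diagonal fun i => D i i := hD.diagonal_diag.symm
  rw [hd]
  ext i j
  rw [Matrix.diagonal_mul, Matrix.mul_diagonal]
  by_cases h : r i j
  · rw [hr i j h, mul_comm]
  · simp [hB i j h]

/-- The equation `[D, K] + B - bdiag B = 0` is solved entrywise: off the finer blocks but inside
the coarser ones the eigenvalues of `D` differ, so one may divide by their difference. -/
theorem exists_isBlockDiag_sylvester {m : ℕ} {r r' : Fin m → Fin m → Prop} {D B : Mat m}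
    (hD : D.IsDiag) (hr : ∀ i j, r' i j ↔ r i j ∧ D i i = D j j) (hB : IsBlockDiag r B) :
    ∃ K : Mat m, IsBlockDiag r K ∧ (D * K - K * D) + B - bdiag r' B = 0 := by
  classical
  have hd : D = Matrix.diagonal fun i => D i i := hD.diagonal_diag.symm
  refine ⟨Matrix.of fun i j => -(B i j) / (D i i - D j j), fun i j h => by simp [hB i j h], ?_⟩
  rw [hd]
  ext i j
  simp only [Matrix.sub_apply, Matrix.add_apply, Matrix.diagonal_mul, Matrix.mul_diagonal,
    Matrix.of_apply, bdiag, Matrix.zero_apply, Matrix.diagonal_apply_eq]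
  by_cases h : r i j
  · by_cases h' : D i i = D j j
    · rw [if_pos ((hr i j).2 ⟨h, h'⟩), h']; simp
    · rw [if_neg fun hh => h' ((hr i j).1 hh).2]
      have : D i i - D j j ≠ 0 := sub_ne_zero.2 h'
      field_simp
      ring
  · rw [if_neg fun hh => h ((hr i j).1 hh).1, hB i j h]
    simp

/-- A matrix that is diagonable and block-diagonal can be diagonalised together with all diagonal
matrices that are scalar on the blocks. The blocks are the fibres of `f`. -/
theorem Diagonable.exists_simultaneous {m : ℕ} {κ : Type*} {f : Fin m → κ} {B : Mat m}
    (hB : Diagonable B) (hf : IsBlockDiag (fun i j => f i = f j) B) :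
    ∃ Q : (Mat m)ˣ, ((↑Q⁻¹ : Mat m) * B * (Q : Mat m)).IsDiag ∧
      ∀ D : Mat m, D.IsDiag → (∀ i j, f i = f j → D i i = D j j) →
        ((↑Q⁻¹ : Mat m) * D * (Q : Mat m)).IsDiag := by
  classical
  obtain ⟨P, hP⟩ := hB
  -- The block components of the eigenvectors of `B` are again eigenvectors of `B`, and they span.
  let v : κ → Fin m → (Fin m → ℂ) := fun q c i => if f i = q then (P : Mat m) i c else 0
  let s : Set (Fin m → ℂ) := {x | ∃ q c, x = v q c}
  have hspan : ⊤ ≤ Submodule.span ℂ s := by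
    intro x _
    have hcol : ∀ c, (fun i => (P : Mat m) i c) ∈ Submodule.span ℂ s := by
      intro c
      have : (fun i => (P : Mat m) i c) = ∑ q ∈ Finset.univ.image f, v q c := by
        ext i
        simp only [v, Finset.sum_apply]
        rw [Finset.sum_ite_eq, if_pos (by simp)]
      rw [this]
      exact Submodule.sum_mem _ fun q _ => Submodule.subset_span ⟨q, c, rfl⟩
    have hx : x = ∑ c, ((↑P⁻¹ : Mat m).mulVec x) c • (fun i => (P : Mat m) i c) := by
      have h1 : (P : Mat m).mulVec ((↑P⁻¹ : Mat m).mulVec x) = x := by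
        rw [Matrix.mulVec_mulVec, Units.mul_inv, Matrix.one_mulVec]
      conv_lhs => rw [← h1]
      ext i
      simp [Matrix.mulVec, dotProduct, mul_comm]
    rw [hx]
    exact Submodule.sum_mem _ fun c _ => Submodule.smul_mem _ _ (hcol c)
  let b0 := Module.Basis.ofSpan hspan
  let b := b0.reindex (b0.indexEquiv (Pi.basisFun ℂ (Fin m)))
  have hb : ∀ j, b j ∈ s := fun j => Module.Basis.ofSpan_subset hspan (by
    simp only [b, Module.Basis.reindex_apply]; exact ⟨_, rfl⟩)
  let N : Mat m := (Pi.basisFun ℂ (Fin m)).toMatrix b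
  let N' : Mat m := b.toMatrix (Pi.basisFun ℂ (Fin m))
  let Q : (Mat m)ˣ := ⟨N, N', Module.Basis.toMatrix_mul_toMatrix_flip _ _,
    Module.Basis.toMatrix_mul_toMatrix_flip _ _⟩
  have hQ : ∀ i j, (Q : Mat m) i j = b j i := fun i j => by
    simp [Q, N, Module.Basis.toMatrix_apply]
  have key : ∀ X : Mat m, (∀ j, ∃ μ : ℂ, X.mulVec (b j) = μ • b j) →
      ((↑Q⁻¹ : Mat m) * X * (Q : Mat m)).IsDiag := by
    intro X hX
    choose μ hμ using hX
    have : X * (Q : Mat m) = (Q : Mat m) * Matrix.diagonal μ := by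
      ext i j
      rw [Matrix.mul_diagonal, hQ, Matrix.mul_apply]
      have := congrFun (hμ j) i
      simp only [Matrix.mulVec, dotProduct, Pi.smul_apply, smul_eq_mul] at this
      simp only [hQ]
      rw [this, mul_comm]
    rw [mul_assoc, this, ← mul_assoc, Units.inv_mul, one_mul]
    exact Matrix.isDiag_diagonal μ
  refine ⟨Q, key B fun j => ?_, fun D hD hDf => key D fun j => ?_⟩
  · obtain ⟨q, c, hqc⟩ := hb j
    refine ⟨((↑P⁻¹ : Mat m) * B * (P : Mat m)) c c, ?_⟩
    rw [hqc]
    set Δ := (↑P⁻¹ : Mat m) * B * (P : Mat m) with hΔ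
    have hBP : B * (P : Mat m) = (P : Mat m) * Δ := by
      rw [hΔ, mul_assoc, ← mul_assoc, Units.mul_inv, one_mul]
    have hent : ∀ i, ∑ k, B i k * (P : Mat m) k c = Δ c c * (P : Mat m) i c := by
      intro i
      have := congrFun (congrFun hBP i) c
      rw [Matrix.mul_apply, Matrix.mul_apply] at this
      rw [this, Finset.sum_eq_single c (fun k _ hk => by rw [hP hk, mul_zero]) (by simp), mul_comm]
    ext i
    simp only [Matrix.mulVec, dotProduct, Pi.smul_apply, smul_eq_mul, v]
    by_cases hi : f i = q
    · rw [if_pos hi, ← hent i]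
      refine Finset.sum_congr rfl fun k _ => ?_
      by_cases hk : f k = q
      · rw [if_pos hk]
      · rw [if_neg hk, hf i k (fun h => hk (h ▸ hi))]; simp
    · rw [if_neg hi, mul_zero]
      refine Finset.sum_eq_zero fun k _ => ?_
      by_cases hk : f k = q
      · rw [hf i k (fun h => hi (h ▸ hk)), zero_mul]
      · rw [if_neg hk, mul_zero]
  · obtain ⟨q, c, hqc⟩ := hb j
    rw [hqc]
    have hrow : ∀ i, D.mulVec (v q c) i = D i i * v q c i := by
      intro i
      rw [Matrix.mulVec, dotProduct, Finset.sum_eq_single i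
        (fun k _ hk => by rw [hD (Ne.symm hk), zero_mul]) (by simp)]
    by_cases hq : ∃ i₀, f i₀ = q
    · obtain ⟨i₀, hi₀⟩ := hq
      refine ⟨D i₀ i₀, ?_⟩
      ext i
      rw [hrow, Pi.smul_apply, smul_eq_mul]
      by_cases hi : f i = q
      · rw [hDf i i₀ (hi.trans hi₀.symm)]
      · simp [v, hi]
    · refine ⟨0, ?_⟩
      ext i
      rw [hrow]
      have : f i ≠ q := fun h => hq ⟨i, h⟩
      simp [v, this]

/-! ### The multi-step scheme on formal power series -/

namespace SchemeChoices

variable {m : ℕ} {a : ℕ → Mat m} {S : SchemeChoices m}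

theorem sameGroup_succ_iff (l : ℕ) (i j : Fin m) :
    SameGroup a S (l + 1) i j ↔ SameGroup a S l i j ∧ Lam a S l i i = Lam a S l j j :=
  ⟨fun h => ⟨fun q hq => h q (by omega), h l (by omega)⟩, fun h q hq => by
    rcases Nat.lt_succ_iff_lt_or_eq.1 hq with hq | rfl
    exacts [h.1 q hq, h.2]⟩

theorem isBlockDiag_subStep (k l : ℕ) : IsBlockDiag (SameGroup a S l) (subStep a S k l) := by
  classical
  cases l with
  | zero => exact fun i j h => (h fun q hq => absurd hq (Nat.not_lt_zero q)).elim
  | succ l => exact fun i j h => by simp [subStep, bdiag, h]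

/-- The sub-steps of step `k` applied to a series `E` whose coefficients up to `ρ ^ k` are
`Λ_0, …, Λ_k`: these coefficients persist, and the next one runs through the matrices
`subStep a S k`. -/
theorem exists_conj_subSteps {k : ℕ} (K : ℕ → Mat m)
    (hLam : ∀ j ≤ k, PowerSeries.coeff j (expansion a S k) = Lam a S j)
    (hdiag : ∀ j ≤ k, (Lam a S j).IsDiag)
    (hsyl : ∀ l ≤ k, (Lam a S l * K l - K l * Lam a S l)
      + subStep a S k l - subStep a S k (l + 1) = 0)
    (hblock : ∀ l ≤ k, IsBlockDiag (SameGroup a S l) (K l)) (r : ℕ) (hr : r ≤ k + 1) :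
    ∃ B : PowerSeries (Mat m),
      expansion a S k * ((List.range r).map fun l =>
          (1 + PowerSeries.monomial (k + 1 - l) (K l) : PowerSeries (Mat m))).prod
        = ((List.range r).map fun l =>
          (1 + PowerSeries.monomial (k + 1 - l) (K l) : PowerSeries (Mat m))).prod * B ∧
      (∀ j ≤ k, PowerSeries.coeff j B = Lam a S j) ∧
      PowerSeries.coeff (k + 1) B = subStep a S k r := by
  induction r with
  | zero => exact ⟨expansion a S k, by simp, hLam, rfl⟩
  | succ r ih =>
    obtain ⟨B, h1, h2, h3⟩ := ih (by omega)
    have hcomm : ∀ j < r, Commute (PowerSeries.coeff j B) (K r) := fun j hj => by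
      rw [h2 j (by omega)]
      exact commute_of_isDiag_of_isBlockDiag (hdiag j (by omega)) (fun i i' h => h j hj)
        (hblock r (by omega))
    obtain ⟨B', e1, e2, e3⟩ := PowerSeries.exists_conj_one_add_monomial B (K r)
      (p := k + 1 - r) (by omega) hcomm
    rw [show k + 1 - r + r = k + 1 by omega] at e2 e3
    refine ⟨B', ?_, fun j hj => (e2 j (by omega)).trans (h2 j hj), ?_⟩
    · rw [List.range_succ, List.map_append, List.prod_append, List.map_singleton,
        List.prod_singleton, ← mul_assoc, h1, mul_assoc, e1, mul_assoc]
    · rw [e3, h3, h2 r (by omega)]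
      have := hsyl r (by omega)
      rw [sub_eq_zero] at this
      rw [← this, add_comm]

/-- Along the scheme the leading coefficients persist and are diagonal. -/
theorem IsAdmissible.coeff_expansion {n : ℕ} (h : IsAdmissible a S n) :
    ∀ k < n, ∀ j ≤ k,
      PowerSeries.coeff j (expansion a S k) = Lam a S j ∧ (Lam a S j).IsDiag := by
  intro k
  induction k with
  | zero =>
    intro hk j hj
    obtain rfl : j = 0 := by omega
    refine ⟨rfl, ?_⟩
    have := h.diagonalises 0 hk
    rwa [Lam, expansion, PowerSeries.coeff_mul_C, PowerSeries.coeff_C_mul, PowerSeries.coeff_mk]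
  | succ k ih =>
    intro hk j hj
    have ih := ih (by omega)
    obtain ⟨B, h1, h2, h3⟩ := exists_conj_subSteps (S.K k) (fun j hj => (ih j hj).1)
      (fun j hj => (ih j hj).2) (h.sylvester k hk) (h.blockDiag_K k hk) (k + 1) le_rfl
    have hexp : expansion a S (k + 1)
        = PowerSeries.C (↑(S.M (k + 1))⁻¹ : Mat m) * B * PowerSeries.C (S.M (k + 1) : Mat m) := by
      have hT : expansion a S k * S.stepTransform k = S.stepTransform k
          * (PowerSeries.C (↑(S.M (k + 1))⁻¹ : Mat m) * B
            * PowerSeries.C (S.M (k + 1) : Mat m)) := by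
        rw [stepTransform, ← mul_assoc, h1]
        simp only [mul_assoc]
        rw [← mul_assoc (PowerSeries.C (S.M (k + 1) : Mat m)), ← map_mul, Units.mul_inv, map_one,
          one_mul]
      rw [expansion, mul_assoc, hT, ← mul_assoc, inv_mul_stepTransform, one_mul]
    have hcoeff : ∀ i, PowerSeries.coeff i (expansion a S (k + 1))
        = (↑(S.M (k + 1))⁻¹ : Mat m) * PowerSeries.coeff i B * (S.M (k + 1) : Mat m) := fun i => by
      rw [hexp, PowerSeries.coeff_mul_C, PowerSeries.coeff_C_mul]
    rcases Nat.lt_or_eq_of_le hj with hj | rfl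
    · have hj : j ≤ k := by omega
      refine ⟨?_, (ih j hj).2⟩
      have hc := commute_of_isDiag_of_isBlockDiag (ih j hj).2 (fun i i' h => h j (by omega))
        (h.blockDiag_M (k + 1) hk)
      rw [hcoeff, h2 j hj, mul_assoc, hc.eq, ← mul_assoc, Units.inv_mul, one_mul]
    · refine ⟨rfl, ?_⟩
      rw [Lam, hcoeff, h3]
      exact h.diagonalises (k + 1) hk

theorem exists_expansion_eq_conj (a : ℕ → Mat m) (S : SchemeChoices m) (k : ℕ) :
    ∃ T : PowerSeries (Mat m), IsUnit (PowerSeries.constantCoeff T) ∧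
      PowerSeries.mk a * T = T * expansion a S k := by
  induction k with
  | zero =>
    refine ⟨PowerSeries.C (S.M 0 : Mat m), by simp, ?_⟩
    rw [expansion, ← mul_assoc, ← mul_assoc, ← map_mul, Units.mul_inv, map_one, one_mul]
  | succ k ih =>
    obtain ⟨T, hT, h⟩ := ih
    refine ⟨T * S.stepTransform k, ?_, ?_⟩
    · rw [map_mul, constantCoeff_stepTransform]
      exact hT.mul (Units.isUnit _)
    · rw [← mul_assoc, h, expansion]
      simp only [mul_assoc]
      rw [← mul_assoc (S.stepTransform k), stepTransform_mul_inv, one_mul]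

end SchemeChoices

open SchemeChoices in
/-- Under Assumption (A_n) the formal series `∑ ρ ^ j a_j` is conjugate to a series that is diagonal
up to `ρ ^ n`. In the last step the diagonaliser need not respect the blocks: it suffices that it
keeps `Λ_0, …, Λ_{n-1}` diagonal. -/
theorem AssumptionA.exists_formal_diagonalisation {m : ℕ} {a : ℕ → Mat m} {n : ℕ}
    (h : AssumptionA a n) :
    ∃ T E : PowerSeries (Mat m), IsUnit (PowerSeries.constantCoeff T) ∧
      PowerSeries.mk a * T = T * E ∧ ∀ j ≤ n, (PowerSeries.coeff j E).IsDiag := by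
  obtain ⟨S, hS, hdiag⟩ := h
  cases n with
  | zero =>
    obtain ⟨P, hP⟩ := hdiag 0 le_rfl
    refine ⟨PowerSeries.C (P : Mat m),
      PowerSeries.C (↑P⁻¹ : Mat m) * PowerSeries.mk a * PowerSeries.C (P : Mat m), by simp, ?_, ?_⟩
    · rw [← mul_assoc, ← mul_assoc, ← map_mul, Units.mul_inv, map_one, one_mul]
    · intro j hj
      obtain rfl : j = 0 := by omega
      rwa [PowerSeries.coeff_mul_C, PowerSeries.coeff_C_mul, PowerSeries.coeff_mk]
  | succ k =>
    have hk := hS.coeff_expansion k (by omega)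
    have hK : ∀ l, ∃ K : Mat m, l ≤ k → IsBlockDiag (SameGroup a S l) K ∧
        (Lam a S l * K - K * Lam a S l) + subStep a S k l - subStep a S k (l + 1) = 0 := by
      intro l
      by_cases hl : l ≤ k
      · obtain ⟨K, hK⟩ := exists_isBlockDiag_sylvester (hk l hl).2 (sameGroup_succ_iff l)
          (isBlockDiag_subStep k l)
        exact ⟨K, fun _ => hK⟩
      · exact ⟨0, fun h => absurd h hl⟩
    choose K hK using hK
    obtain ⟨B, h1, h2, h3⟩ := exists_conj_subSteps K (fun j hj => (hk j hj).1)
      (fun j hj => (hk j hj).2) (fun l hl => (hK l hl).2) (fun l hl => (hK l hl).1) (k + 1) le_rfl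
    set L := ((List.range (k + 1)).map fun l =>
      (1 + PowerSeries.monomial (k + 1 - l) (K l) : PowerSeries (Mat m))).prod with hL
    have hL0 : PowerSeries.constantCoeff L = 1 := by
      -- `L` is the step transformation of a scheme with trivial diagonalisers.
      have := constantCoeff_stepTransform (⟨fun _ => 1, fun _ => K⟩ : SchemeChoices m) k
      simpa [stepTransform] using this
    let f : Fin m → Fin (k + 1) → ℂ := fun i q => Lam a S q i i
    have hf : ∀ i j, f i = f j ↔ SameGroup a S (k + 1) i j := fun i j =>
      ⟨fun h q hq => congrFun h ⟨q, hq⟩, fun h => funext fun q => h q q.2⟩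
    have hbd : IsBlockDiag (fun i j => f i = f j) (LamTilde a S (k + 1)) := fun i j hij =>
      isBlockDiag_subStep k (k + 1) i j fun h => hij ((hf i j).2 h)
    obtain ⟨Q, hQ, hQD⟩ := (hdiag (k + 1) le_rfl).exists_simultaneous hbd
    obtain ⟨T, hT, hTe⟩ := exists_expansion_eq_conj a S k
    refine ⟨T * L * PowerSeries.C (Q : Mat m),
      PowerSeries.C (↑Q⁻¹ : Mat m) * B * PowerSeries.C (Q : Mat m), ?_, ?_, ?_⟩
    · rw [map_mul, map_mul, hL0, mul_one, PowerSeries.constantCoeff_C]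
      exact hT.mul Q.isUnit
    · have h4 : PowerSeries.C (Q : Mat m) * PowerSeries.C (↑Q⁻¹ : Mat m) = 1 := by
        rw [← map_mul, Units.mul_inv, map_one]
      calc PowerSeries.mk a * (T * L * PowerSeries.C (Q : Mat m))
          = (PowerSeries.mk a * T) * L * PowerSeries.C (Q : Mat m) := by simp only [mul_assoc]
        _ = T * (expansion a S k * L) * PowerSeries.C (Q : Mat m) := by
            rw [hTe]; simp only [mul_assoc]
        _ = T * L * (PowerSeries.C (Q : Mat m) * PowerSeries.C (↑Q⁻¹ : Mat m)) * B
              * PowerSeries.C (Q : Mat m) := by rw [h1, h4]; simp only [mul_assoc, one_mul]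
        _ = _ := by simp only [mul_assoc]
    · intro j hj
      rw [PowerSeries.coeff_mul_C, PowerSeries.coeff_C_mul]
      rcases Nat.lt_or_eq_of_le hj with hj | rfl
      · have hj : j ≤ k := by omega
        rw [h2 j hj]
        exact hQD _ (hk j hj).2 fun i i' hii' => (hf i i').1 hii' j (by omega)
      · rw [h3]
        exact hQ

/-! ### Truncated series and their values -/

attribute [local instance] Matrix.linftyOpNormedAlgebra

section Truncation

variable {𝕜 R : Type*} [NormedField 𝕜]

/-- The value at `ρ` of the truncation of a power series to degrees below `N`. -/
noncomputable def truncEval [Ring R] [Algebra 𝕜 R] (N : ℕ) (f : PowerSeries R) (ρ : 𝕜) : R :=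
  ∑ j ∈ Finset.range N, ρ ^ j • PowerSeries.coeff j f

theorem truncEval_zero [Ring R] [Algebra 𝕜 R] (N : ℕ) (f : PowerSeries R) :
    truncEval (N + 1) f (0 : 𝕜) = PowerSeries.constantCoeff f := by
  rw [truncEval, Finset.sum_range_succ']
  simp

theorem continuous_truncEval [NormedRing R] [NormedAlgebra 𝕜 R] (N : ℕ) (f : PowerSeries R) :
    Continuous (truncEval (𝕜 := 𝕜) N f) := by
  unfold truncEval
  fun_prop

/-- Truncated evaluation is multiplicative up to the order of truncation. -/
theorem truncEval_mul_sub_isBigO [NormedRing R] [NormedAlgebra 𝕜 R] (N : ℕ)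
    (f g : PowerSeries R) :
    (fun ρ : 𝕜 => truncEval N f ρ * truncEval N g ρ - truncEval N (f * g) ρ)
      =O[𝓝 0] fun ρ : 𝕜 => ρ ^ N := by
  classical
  have hrem : ∀ ρ : 𝕜, truncEval N f ρ * truncEval N g ρ - truncEval N (f * g) ρ
      = ∑ x ∈ (Finset.range N ×ˢ Finset.range N).filter (fun x => ¬ x.1 + x.2 < N),
          ρ ^ (x.1 + x.2) • (PowerSeries.coeff x.1 f * PowerSeries.coeff x.2 g) := by
    intro ρ
    have h1 : truncEval N f ρ * truncEval N g ρ
        = ∑ x ∈ Finset.range N ×ˢ Finset.range N,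
          ρ ^ (x.1 + x.2) • (PowerSeries.coeff x.1 f * PowerSeries.coeff x.2 g) := by
      rw [truncEval, truncEval, Finset.sum_mul_sum, ← Finset.sum_product']
      refine Finset.sum_congr rfl fun x _ => ?_
      rw [smul_mul_smul_comm, pow_add]
    have h2 : truncEval N (f * g) ρ
        = ∑ x ∈ (Finset.range N ×ˢ Finset.range N).filter (fun x => x.1 + x.2 < N),
          ρ ^ (x.1 + x.2) • (PowerSeries.coeff x.1 f * PowerSeries.coeff x.2 g) := by
      rw [truncEval, ← Finset.sum_fiberwise_of_maps_to (t := Finset.range N)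
        (g := fun x : ℕ × ℕ => x.1 + x.2)
        (fun x hx => Finset.mem_range.2 (Finset.mem_filter.1 hx).2)]
      refine Finset.sum_congr rfl fun j hj => ?_
      rw [PowerSeries.coeff_mul, Finset.smul_sum]
      have hj := Finset.mem_range.1 hj
      refine Finset.sum_congr ?_ fun x hx => ?_
      · ext x
        simp only [Finset.HasAntidiagonal.mem_antidiagonal, Finset.mem_filter, Finset.mem_product,
          Finset.mem_range]
        omega
      · rw [(Finset.mem_filter.1 hx).2]
    rw [h1, h2, ← Finset.sum_filter_add_sum_filter_not (Finset.range N ×ˢ Finset.range N)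
      (fun x => x.1 + x.2 < N), add_sub_cancel_left]
  rw [show (fun ρ : 𝕜 => truncEval N f ρ * truncEval N g ρ - truncEval N (f * g) ρ) = _ from
    funext hrem]
  refine IsBigO.fun_sum fun x hx => ?_
  obtain ⟨d, hd⟩ := Nat.exists_eq_add_of_le (not_lt.1 (Finset.mem_filter.1 hx).2)
  have hc : Continuous fun ρ : 𝕜 =>
      ρ ^ d • (PowerSeries.coeff x.1 f * PowerSeries.coeff x.2 g) := by fun_prop
  have hO := (isBigO_refl (fun ρ : 𝕜 => ρ ^ N) (𝓝 0)).smul ((hc.tendsto 0).isBigO_one 𝕜)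
  simpa [hd, pow_add, mul_smul] using hO

end Truncation

theorem HasAsymptoticExpansion.apply_zero {𝕜 : Type*} [RCLike 𝕜] [NormedAlgebra 𝕜 ℂ] {m : ℕ}
    {A : 𝕜 → Mat m} (hA : ContinuousAt A 0) {a : ℕ → Mat m} (h : HasAsymptoticExpansion A a) :
    A 0 = a 0 := by
  have h0 := h 0
  simp only [zero_add, Finset.sum_range_one, pow_zero, one_smul, pow_one] at h0
  have h1 : Tendsto (fun ρ : 𝕜 => A ρ - a 0) (𝓝[≠] 0) (𝓝 0) :=
    h0.trans_tendsto (tendsto_id.mono_left nhdsWithin_le_nhds)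
  have h2 : Tendsto (fun ρ : 𝕜 => A ρ - a 0) (𝓝[≠] 0) (𝓝 (A 0 - a 0)) :=
    (hA.tendsto.mono_left nhdsWithin_le_nhds).sub tendsto_const_nhds
  exact sub_eq_zero.1 (tendsto_nhds_unique h2 h1)

/-- By continuity, an asymptotic expansion as `ρ → 0` also holds at `ρ = 0`. -/
theorem HasAsymptoticExpansion.isBigO_nhds {𝕜 : Type*} [RCLike 𝕜] [NormedAlgebra 𝕜 ℂ] {m : ℕ}
    {A : 𝕜 → Mat m} (hA : ContinuousAt A 0) {a : ℕ → Mat m} (h : HasAsymptoticExpansion A a)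
    (N : ℕ) : (fun ρ : 𝕜 => A ρ - truncEval (N + 1) (PowerSeries.mk a) ρ)
      =O[𝓝 0] fun ρ : 𝕜 => ρ ^ (N + 1) := by
  rw [← nhdsNE_sup_pure, isBigO_sup]
  refine ⟨by simpa [truncEval] using h N, ?_⟩
  rw [isBigO_pure]
  intro _
  rw [truncEval_zero, HasAsymptoticExpansion.apply_zero hA h,
    ← PowerSeries.coeff_zero_eq_constantCoeff_apply, PowerSeries.coeff_mk, sub_self]

theorem mainTheorem3 {𝕜 : Type*} [RCLike 𝕜] [NormedAlgebra 𝕜 ℂ] {m : ℕ}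
    (A : 𝕜 → Mat m) (hA : Continuous A)
    (a : ℕ → Mat m) (hexp : HasAsymptoticExpansion A a)
    (n : ℕ) (hn : AssumptionA a n) :
    ∃ ε : ℝ, 0 < ε ∧ ∃ (M : 𝕜 → Mat m) (d : 𝕜 → Fin m → ℂ) (C : ℝ),
      ∀ ρ ∈ Metric.ball (0 : 𝕜) ε,
        IsUnit (M ρ) ∧ ‖M ρ‖ ≤ C ∧ ‖(M ρ)⁻¹‖ ≤ C ∧
        ‖(M ρ)⁻¹ * A ρ * M ρ - Matrix.diagonal (d ρ)‖ ≤ C * ‖ρ‖ ^ (n + 1) := by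
  obtain ⟨T, E, hT, hTE, hE⟩ := hn.exists_formal_diagonalisation
  let Q : 𝕜 → Mat m := truncEval (n + 1) T
  let D : 𝕜 → Mat m := truncEval (n + 1) E
  have hQ : Continuous Q := continuous_truncEval _ _
  have hQ0 : Q 0 = PowerSeries.constantCoeff T := truncEval_zero n T
  have hD : ∀ ρ, (D ρ).IsDiag := by
    intro ρ i j hij
    simp only [D, truncEval, Matrix.sum_apply, Matrix.smul_apply]
    refine Finset.sum_eq_zero fun l hl => ?_
    rw [hE l (by simpa [Nat.lt_succ_iff] using hl) hij, smul_zero]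
  have hDd : ∀ ρ, Matrix.diagonal (fun i => D ρ i i) = D ρ := fun ρ => (hD ρ).diagonal_diag
  have hdet0 : (Q 0).det ≠ 0 := by
    rw [hQ0]; exact ((Matrix.isUnit_iff_isUnit_det _).1 hT).ne_zero
  have hunit : ∀ᶠ ρ in 𝓝 (0 : 𝕜), (Q ρ).det ≠ 0 :=
    hQ.matrix_det.continuousAt.eventually_ne hdet0
  have hinv : ContinuousAt (fun ρ => (Q ρ)⁻¹) 0 := by
    have : (fun ρ => (Q ρ)⁻¹) = fun ρ => ((Q ρ).det)⁻¹ • (Q ρ).adjugate := by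
      ext1 ρ
      rw [Matrix.inv_def, Ring.inverse_eq_inv']
    rw [this]
    exact (hQ.matrix_det.continuousAt.inv₀ hdet0).smul hQ.matrix_adjugate.continuousAt
  have hR : (fun ρ => A ρ * Q ρ - Q ρ * D ρ) =O[𝓝 0] fun ρ : 𝕜 => ρ ^ (n + 1) := by
    have h1 := (hexp.isBigO_nhds hA.continuousAt n).mul ((hQ.tendsto 0).isBigO_one 𝕜)
    have h2 := truncEval_mul_sub_isBigO (𝕜 := 𝕜) (n + 1) (PowerSeries.mk a) T
    have h3 := truncEval_mul_sub_isBigO (𝕜 := 𝕜) (n + 1) T E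
    rw [← hTE] at h3
    simp only [mul_one] at h1
    refine ((h1.add h2).sub h3).congr_left fun ρ => ?_
    simp only [Q, D]
    noncomm_ring
  have herr : (fun ρ => (Q ρ)⁻¹ * (A ρ * Q ρ - Q ρ * D ρ)) =O[𝓝 0] fun ρ : 𝕜 => ρ ^ (n + 1) := by
    simpa using (hinv.tendsto.isBigO_one 𝕜).mul hR
  obtain ⟨C₁, hC₁⟩ := ((hQ.tendsto 0).isBigO_one 𝕜).bound
  obtain ⟨C₂, hC₂⟩ := (hinv.tendsto.isBigO_one 𝕜).bound
  obtain ⟨C₃, hC₃⟩ := herr.bound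
  obtain ⟨ε, hε, hball⟩ := Metric.eventually_nhds_iff_ball.1
    (hunit.and (hC₁.and (hC₂.and hC₃)))
  refine ⟨ε, hε, Q, fun ρ i => D ρ i i, max C₁ (max C₂ C₃), fun ρ hρ => ?_⟩
  obtain ⟨h0, h1, h2, h3⟩ := hball ρ hρ
  have hu : IsUnit (Q ρ).det := isUnit_iff_ne_zero.2 h0
  refine ⟨(Matrix.isUnit_iff_isUnit_det _).2 hu, ?_, ?_, ?_⟩
  · exact (h1.trans_eq (by simp)).trans (le_max_left C₁ _)
  · exact (h2.trans_eq (by simp)).trans ((le_max_left C₂ C₃).trans (le_max_right _ _))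
  · rw [hDd, show (Q ρ)⁻¹ * A ρ * Q ρ - D ρ = (Q ρ)⁻¹ * (A ρ * Q ρ - Q ρ * D ρ) by
      rw [mul_sub, ← mul_assoc, ← mul_assoc, Matrix.nonsing_inv_mul _ hu, one_mul]]
    refine h3.trans ?_
    rw [norm_pow]
    gcongr
    exact (le_max_right C₂ C₃).trans (le_max_right _ _)
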